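/- Let $\mathcal H=\{\tfrac12(a+bi+cj+dk) : a,b,c,d\in\mathbb Z,\ a\equiv b\equiv c\equiv d \pmod 2\}$ be the ring of Hurwitz quaternions, with norm $\mathrm N(\alpha)=\alpha\bar\alpha$ and trace $\mathrm{Tr}(\alpha)=\alpha+\bar\alpha$. A Hurwitz prime above a rational prime $p$ is an irreducible element of $\mathcal H$ of norm $p$, and $\Pi_p$ denotes the set of classes of Hurwitz primes above $p$ up to left multiplication by units of $\mathcal H$. Let $p$ and $q$ be distinct rational primes with $p$ odd, and let $\xi$ be a Hurwitz prime above $q$. Then there is a unique permutation $\tau_{\xi,p}$ of $\Pi_p$ (the metacommutation map induced by $\xi$) such that, for all Hurwitz primes $\pi,\pi'$ above $p$, $\tau_{\xi,p}([\pi])=[\pi']$ if and only if $\pi\xi=\xi'\pi'$ for some Hurwitz prime $\xi'$ above $q$. Call a cycle of $\tau_{\xi,p}$ non-trivial if its length is greater than one. Then: 1. $\tau_{\xi,p}$ has non-trivial cycles and all of them have length $4$ if and only if $2\,\mathrm N(\xi)\equiv \mathrm{Tr}(\xi)^2 \pmod p$. 2. $\tau_{\xi,p}$ has non-trivial cycles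 and all of them have length $6$ if and only if $p\neq 3$ and $3\,\mathrm N(\xi)\equiv \mathrm{Tr}(\xi)^2 \pmod p$. -/

import Mathlib

open scoped Quaternion

namespace Hurwitz

/-- The Hurwitz quaternions: the subring of the real Hamilton quaternions formed by the elements
`(a + b i + c j + d k) / 2` with `a, b, c, d` integers of the same parity. -/
noncomputable def hurwitz : Subring ℍ[ℝ] where
  carrier := {x | ∃ a b c d : ℤ, (a ≡ b [ZMOD 2] ∧ b ≡ c [ZMOD 2] ∧ c ≡ d [ZMOD 2]) ∧
    x.re = a / 2 ∧ x.imI = b / 2 ∧ x.imJ = c / 2 ∧ x.imK = d / 2}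
  zero_mem' := ⟨0, 0, 0, 0, ⟨rfl, rfl, rfl⟩, by simp⟩
  one_mem' := ⟨2, 0, 0, 0, ⟨rfl, rfl, rfl⟩, by simp⟩
  add_mem' := by
    rintro x y ⟨a, b, c, d, ⟨h₁, h₂, h₃⟩, hx⟩ ⟨a', b', c', d', ⟨h₁', h₂', h₃'⟩, hy⟩
    refine ⟨a + a', b + b', c + c', d + d', ⟨h₁.add h₁', h₂.add h₂', h₃.add h₃'⟩, ?_⟩
    simp [hx, hy, add_div]
  neg_mem' := by
    rintro x ⟨a, b, c, d, ⟨h₁, h₂, h₃⟩, hx⟩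
    refine ⟨-a, -b, -c, -d, ⟨h₁.neg, h₂.neg, h₃.neg⟩, ?_⟩
    simp [hx, neg_div]
  mul_mem' := by
    rintro x y ⟨a, b, c, d, ⟨h₁, h₂, h₃⟩, hx⟩ ⟨a', b', c', d', ⟨h₁', h₂', h₃'⟩, hy⟩
    obtain ⟨k, hk⟩ := h₁.dvd
    obtain ⟨l, hl⟩ := (h₁.trans h₂).dvd
    obtain ⟨m, hm⟩ := ((h₁.trans h₂).trans h₃).dvd
    obtain ⟨k', hk'⟩ := h₁'.dvd
    obtain ⟨l', hl'⟩ := (h₁'.trans h₂').dvd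
    obtain ⟨m', hm'⟩ := ((h₁'.trans h₂').trans h₃').dvd
    obtain rfl : b = a + 2 * k := by omega
    obtain rfl : c = a + 2 * l := by omega
    obtain rfl : d = a + 2 * m := by omega
    obtain rfl : b' = a' + 2 * k' := by omega
    obtain rfl : c' = a' + 2 * l' := by omega
    obtain rfl : d' = a' + 2 * m' := by omega
    refine ⟨-(a * a') - (a * k' + k * a' + 2 * k * k') - (a * l' + l * a' + 2 * l * l')
        - (a * m' + m * a' + 2 * m * m'),
      a * a' + a * k' + k * a' + (a * m' + l * a' + 2 * l * m') - (a * l' + m * a' + 2 * m * l'),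
      a * a' + a * l' + l * a' + (a * k' + m * a' + 2 * m * k') - (a * m' + k * a' + 2 * k * m'),
      a * a' + a * m' + m * a' + (a * l' + k * a' + 2 * k * l') - (a * k' + l * a' + 2 * l * k'),
      ⟨?_, ?_, ?_⟩, ?_⟩
    · exact Int.modEq_iff_dvd.2 ⟨a * a' + a * k' + k * a' + a * m' + l * a' + k * k' + l * l'
        + m * m' + l * m' - m * l', by ring⟩
    · exact Int.modEq_iff_dvd.2 ⟨a * l' + m * a' - a * m' - k * a' + m * k' - k * m' - l * m'
        + m * l', by ring⟩
    · exact Int.modEq_iff_dvd.2 ⟨a * m' + k * a' - a * k' - l * a' + k * l' - l * k' - m * k'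
        + k * m', by ring⟩
    · simp only [Quaternion.re_mul, Quaternion.imI_mul, Quaternion.imJ_mul, Quaternion.imK_mul,
        hx, hy]
      push_cast
      refine ⟨?_, ?_, ?_, ?_⟩ <;> ring

/-- The norm `N(α) = α * conj α` of a Hurwitz quaternion, as an integer (see `coe_norm`). -/
noncomputable def norm (x : hurwitz) : ℤ := ⌊Quaternion.normSq (x : ℍ[ℝ])⌋

/-- The trace `Tr(α) = α + conj α = 2 Re(α)` of a Hurwitz quaternion, as an integer
(see `coe_trace`). -/
noncomputable def trace (x : hurwitz) : ℤ := ⌊2 * (x : ℍ[ℝ]).re⌋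

/-- No rounding takes place in the definition of `norm`. -/
theorem coe_norm (x : hurwitz) :
    ((norm x : ℝ) : ℍ[ℝ]) = (x : ℍ[ℝ]) * star (x : ℍ[ℝ]) := by
  rw [Quaternion.self_mul_star]
  congr 1
  obtain ⟨x, a, b, c, d, ⟨h₁, h₂, h₃⟩, hx⟩ := x
  obtain ⟨k, hk⟩ := h₁.dvd
  obtain ⟨l, hl⟩ := (h₁.trans h₂).dvd
  obtain ⟨m, hm⟩ := ((h₁.trans h₂).trans h₃).dvd
  obtain rfl : b = a + 2 * k := by omega
  obtain rfl : c = a + 2 * l := by omega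
  obtain rfl : d = a + 2 * m := by omega
  have h : ∀ r : ℝ, (∃ n : ℤ, r = n) → ((⌊r⌋ : ℤ) : ℝ) = r := by
    rintro _ ⟨n, rfl⟩
    simp
  refine h _ ⟨a ^ 2 + a * k + a * l + a * m + k ^ 2 + l ^ 2 + m ^ 2, ?_⟩
  simp only [Quaternion.normSq_def', hx]
  push_cast
  ring

/-- No rounding takes place in the definition of `trace`. -/
theorem coe_trace (x : hurwitz) :
    ((trace x : ℝ) : ℍ[ℝ]) = (x : ℍ[ℝ]) + star (x : ℍ[ℝ]) := by
  rw [Quaternion.self_add_star]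
  obtain ⟨x, a, b, c, d, ⟨h₁, h₂, h₃⟩, hx⟩ := x
  have h : 2 * x.re = a := by rw [hx.1]; ring
  have h' : (⌊2 * x.re⌋ : ℝ) = 2 * x.re := by rw [h, Int.floor_intCast]
  simp only [trace, h']
  push_cast
  rfl

/-- `π` is a Hurwitz prime (an irreducible element) above the rational prime `p`,
that is, of norm `p`. -/
def IsPrimeAbove (π : hurwitz) (p : ℕ) : Prop :=
  Irreducible π ∧ norm π = p

/-- Left association of Hurwitz primes above `p`: `π₂ = u * π₁` for a unit `u`. -/
def leftAssoc (p : ℕ) : Setoid {π : hurwitz // IsPrimeAbove π p} where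
  r π₁ π₂ := ∃ u : hurwitzˣ, (π₂ : hurwitz) = u * (π₁ : hurwitz)
  iseqv :=
    { refl := fun π => ⟨1, by simp⟩
      symm := by
        rintro π₁ π₂ ⟨u, hu⟩
        exact ⟨u⁻¹, by rw [hu, Units.inv_mul_cancel_left]⟩
      trans := by
        rintro π₁ π₂ π₃ ⟨u, hu⟩ ⟨v, hv⟩
        exact ⟨v * u, by rw [hv, hu, Units.val_mul, mul_assoc]⟩ }

/-- The set of classes of left associated Hurwitz primes above `p`. -/
abbrev PrimeClasses (p : ℕ) : Type := Quotient (leftAssoc p)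

/-- The class of a Hurwitz prime above `p`. -/
def primeClass {p : ℕ} (π : {π : hurwitz // IsPrimeAbove π p}) : PrimeClasses p :=
  Quotient.mk (leftAssoc p) π

/-- `τ` is the metacommutation map induced on the classes of primes above `p` by the prime `ξ`
above `q`: it sends the class of `π` to the class of `π'` exactly when `π * ξ = ξ' * π'` for some
prime `ξ'` above `q`. This determines `τ`. -/
def IsMetacommutationMap (ξ : hurwitz) (p q : ℕ) (τ : PrimeClasses p → PrimeClasses p) : Prop :=
  ∀ π π' : {π : hurwitz // IsPrimeAbove π p},
    τ (primeClass π) = primeClass π' ↔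
      ∃ ξ' : hurwitz, IsPrimeAbove ξ' q ∧ (π : hurwitz) * ξ = ξ' * (π' : hurwitz)

/-- The permutation `σ` has non-trivial cycles (cycles of length greater than one), and all of
them have length `t`. The cycle through `x` is non-trivial when `σ x ≠ x`, and its length is the
minimal period of `x` under `σ`. -/
def NontrivialCyclesHaveLength {α : Type*} (σ : Equiv.Perm α) (t : ℕ) : Prop :=
  (∃ x, σ x ≠ x) ∧ ∀ x, σ x ≠ x → Function.minimalPeriod σ x = t

end Hurwitz

/-!
Write `H` for the Hurwitz quaternions. For `p` odd, `H / pH` is the ring of `2 × 2` matrices over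
the field with `p` elements, the classes of primes above `p` are the points of the projective line,
and metacommutation by `ξ` is the action of `ξ`. The proof follows this picture without choosing
an isomorphism with matrices.

* `H` has left Euclidean division, so left ideals are principal. If `p` divides `N(a)` exactly
  once, the generator of `H a + H p` has norm `p`, and it is, up to left units, the only right
  divisor of `a` of norm `p` (`exists_right_divisor`, `right_divisor_unique`). For `a = π * ξ` this
  gives the metacommutation map, and metacommutation by `conj ξ` is its inverse
  (`exists_perm_metacommutes`).
* Since `ξ ^ 2 = Tr(ξ) ξ - N(ξ)`, every power is `ξ ^ k = A ξ + B` with integers `A`, `B`. A class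
  that `ξ` moves returns to itself after `k` steps exactly when `p` divides `A`
  (`isPeriodicPt_iff`). With `t = Tr(ξ)` and `n = N(ξ)`, the coefficient `A` is `t`, `t ^ 2 - n`,
  `t (t ^ 2 - 2 n)` and `t (t ^ 2 - n) (t ^ 2 - 3 n)` for `k = 2, 3, 4, 6`. As `p` divides neither
  `2` nor `n`, comparing these gives the two criteria.
* Some class is moved unless `p` divides `t ^ 2 - 4 n` (`dvd_discrim_of_forall_fixed`). If all
  classes are fixed, then `p` divides `α * ξ * conj α` for every `α = 1 + u` whose norm is divisible
  by `p` exactly once. The choices `u = ± (a i + b j)`, and the same with the other pairs of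
  coordinates, where `a ^ 2 + b ^ 2 + 1 = k p` with `0 < k < p`, show that `p` divides the
  imaginary part of `2 ξ`.
-/

namespace Hurwitz

/-! ### Norm, trace and conjugation -/

theorem cast_norm (x : hurwitz) : (norm x : ℝ) = Quaternion.normSq (x : ℍ[ℝ]) := by
  have h := coe_norm x
  rw [Quaternion.self_mul_star] at h
  exact Quaternion.coe_injective h

theorem cast_trace (x : hurwitz) : (trace x : ℝ) = 2 * (x : ℍ[ℝ]).re := by
  simpa [two_mul] using congrArg (fun z : ℍ[ℝ] => z.re) (coe_trace x)

theorem norm_mul (x y : hurwitz) : norm (x * y) = norm x * norm y := by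
  have : (norm (x * y) : ℝ) = norm x * norm y := by simp [cast_norm]
  exact_mod_cast this

theorem norm_intCast (n : ℤ) : norm (n : hurwitz) = n ^ 2 := by
  have : (norm (n : hurwitz) : ℝ) = (n : ℝ) ^ 2 := by
    rw [cast_norm, Subring.coe_intCast, Quaternion.normSq_intCast]
  exact_mod_cast this

theorem norm_one : norm 1 = 1 := by simpa using norm_intCast 1

theorem norm_pow (x : hurwitz) (k : ℕ) : norm (x ^ k) = norm x ^ k := by
  induction k with
  | zero => simp [norm_one]
  | succ k ih => rw [pow_succ, norm_mul, ih, pow_succ]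

theorem norm_nonneg (x : hurwitz) : 0 ≤ norm x := by
  have : (0 : ℝ) ≤ norm x := by
    rw [cast_norm]
    exact Quaternion.normSq_nonneg
  exact_mod_cast this

theorem norm_eq_zero {x : hurwitz} : norm x = 0 ↔ x = 0 := by
  rw [← Int.cast_eq_zero (α := ℝ), cast_norm, Quaternion.normSq_eq_zero, ZeroMemClass.coe_eq_zero]

/-- Conjugation of Hurwitz quaternions, written as `Tr(x) - x`, which is visibly again a Hurwitz
quaternion. -/
noncomputable def conj (x : hurwitz) : hurwitz := (trace x : hurwitz) - x

theorem coe_intCast (n : ℤ) : ((n : hurwitz) : ℍ[ℝ]) = ((n : ℝ) : ℍ[ℝ]) := rfl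

theorem coe_conj (x : hurwitz) : (conj x : ℍ[ℝ]) = star (x : ℍ[ℝ]) := by
  rw [conj, AddSubgroupClass.coe_sub, coe_intCast, coe_trace, add_sub_cancel_left]

theorem mul_conj (x : hurwitz) : x * conj x = (norm x : hurwitz) := by
  apply Subtype.ext
  rw [Subring.coe_mul, coe_conj, ← coe_norm, coe_intCast]

theorem conj_conj (x : hurwitz) : conj (conj x) = x := by
  apply Subtype.ext
  simp [coe_conj]

theorem conj_mul (x y : hurwitz) : conj (x * y) = conj y * conj x := by
  apply Subtype.ext
  simp [coe_conj]

theorem norm_conj (x : hurwitz) : norm (conj x) = norm x := by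
  have : (norm (conj x) : ℝ) = norm x := by simp [cast_norm, coe_conj]
  exact_mod_cast this

theorem conj_mul_self (x : hurwitz) : conj x * x = (norm x : hurwitz) := by
  simpa only [conj_conj, norm_conj] using mul_conj (conj x)

theorem sq_eq (x : hurwitz) : x ^ 2 = (trace x : hurwitz) * x - (norm x : hurwitz) := by
  rw [← conj_mul_self, conj]
  noncomm_ring

theorem isUnit_iff_norm_eq_one {x : hurwitz} : IsUnit x ↔ norm x = 1 := by
  constructor
  · rintro ⟨u, rfl⟩
    refine Int.eq_one_of_mul_eq_one_right (norm_nonneg _) (b := norm (↑u⁻¹ : hurwitz)) ?_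
    rw [← norm_mul, Units.mul_inv, norm_one]
  · intro h
    exact ⟨⟨x, conj x, by simp [mul_conj, h], by simp [conj_mul_self, h]⟩, rfl⟩

theorem isPrimeAbove_iff {x : hurwitz} {p : ℕ} (hp : p.Prime) :
    IsPrimeAbove x p ↔ norm x = p := by
  refine ⟨fun h => h.2, fun h => ⟨⟨?_, ?_⟩, h⟩⟩
  · rw [isUnit_iff_norm_eq_one, h]
    exact_mod_cast hp.one_lt.ne'
  · rintro a b rfl
    rw [norm_mul] at h
    have hirr := (Nat.prime_iff_prime_int.1 hp).irreducible
    rw [← h] at hirr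
    rw [isUnit_iff_norm_eq_one, isUnit_iff_norm_eq_one]
    have ha := norm_nonneg a
    have hb := norm_nonneg b
    rcases hirr.isUnit_or_isUnit rfl with h | h <;> rw [Int.isUnit_iff] at h <;> omega

/-! ### Euclidean division and right divisors of norm `p` -/

/-- The real Hamilton quaternions are covered by the open unit balls about the Hurwitz
quaternions. -/
theorem exists_normSq_sub_lt_one (z : ℍ[ℝ]) :
    ∃ x : hurwitz, Quaternion.normSq (z - (x : ℍ[ℝ])) < 1 := by
  have key (r : ℝ) : (r - round r) ^ 2 ≤ 1 / 4 := by
    have := abs_le.1 (abs_sub_round r)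
    nlinarith
  by_cases hlt : (z.re - round z.re) ^ 2 + (z.imI - round z.imI) ^ 2 + (z.imJ - round z.imJ) ^ 2
      + (z.imK - round z.imK) ^ 2 < 1
  · refine ⟨⟨⟨round z.re, round z.imI, round z.imJ, round z.imK⟩, 2 * round z.re,
      2 * round z.imI, 2 * round z.imJ, 2 * round z.imK, ?_, ?_⟩, ?_⟩
    · simp [Int.ModEq]
    · simp
    · rw [Quaternion.normSq_def']
      exact hlt
  · -- Rounding fails only when every coordinate lies halfway between two integers, and then `z`
    -- is itself a Hurwitz quaternion.
    have half (r : ℝ) (hr : 1 / 4 ≤ (r - round r) ^ 2) : ∃ n : ℤ, r = (2 * n + 1 : ℤ) / 2 := by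
      have h4 := (key r).antisymm hr
      have : (r - round r - 1 / 2) * (r - round r + 1 / 2) = 0 := by linarith
      rcases mul_eq_zero.1 this with h | h
      · exact ⟨round r, by push_cast; linarith⟩
      · exact ⟨round r - 1, by push_cast; linarith⟩
    have h1 := key z.re
    have h2 := key z.imI
    have h3 := key z.imJ
    have h4 := key z.imK
    obtain ⟨a, ha⟩ := half z.re (by linarith)
    obtain ⟨b, hb⟩ := half z.imI (by linarith)
    obtain ⟨c, hc⟩ := half z.imJ (by linarith)
    obtain ⟨d, hd⟩ := half z.imK (by linarith)
    refine ⟨⟨z, _, _, _, _, ?_, ha, hb, hc, hd⟩, by simp⟩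
    simp [Int.ModEq, Int.add_emod]

theorem exists_norm_sub_mul_lt (a : hurwitz) {b : hurwitz} (hb : b ≠ 0) :
    ∃ c : hurwitz, norm (a - c * b) < norm b := by
  obtain ⟨c, hc⟩ := exists_normSq_sub_lt_one ((a : ℍ[ℝ]) * (b : ℍ[ℝ])⁻¹)
  refine ⟨c, ?_⟩
  have hb' : (b : ℍ[ℝ]) ≠ 0 := by simpa using hb
  have hpos : 0 < Quaternion.normSq (b : ℍ[ℝ]) :=
    Quaternion.normSq_nonneg.lt_of_ne' (Quaternion.normSq_ne_zero.2 hb')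
  have heq : ((a - c * b : hurwitz) : ℍ[ℝ]) = ((a : ℍ[ℝ]) * (b : ℍ[ℝ])⁻¹ - c) * b := by
    rw [sub_mul, inv_mul_cancel_right₀ hb']
    simp
  have : (norm (a - c * b) : ℝ) < norm b := by
    rw [cast_norm, cast_norm, heq, map_mul]
    exact mul_lt_of_lt_one_left hpos hc
  exact_mod_cast this

theorem exists_eq_span_singleton (I : Ideal hurwitz) : ∃ g, I = Ideal.span {g} := by
  by_cases hI : ∃ x ∈ I, x ≠ 0
  · obtain ⟨g, ⟨hg, hg0⟩, hmin⟩ := (measure fun x : hurwitz => (norm x).toNat).wf.has_min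
      {x | x ∈ I ∧ x ≠ 0} hI
    refine ⟨g, le_antisymm (fun x hx => ?_) ((Ideal.span_singleton_le_iff_mem _).2 hg)⟩
    obtain ⟨c, hc⟩ := exists_norm_sub_mul_lt x hg0
    rw [Ideal.mem_span_singleton']
    refine ⟨c, ?_⟩
    by_contra hne
    refine hmin (x - c * g)
      ⟨I.sub_mem hx (I.mul_mem_left c hg), fun h => hne (sub_eq_zero.1 h).symm⟩ ?_
    have h0 := norm_nonneg (x - c * g)
    change (norm (x - c * g)).toNat < (norm g).toNat
    omega
  · push Not at hI
    exact ⟨0, by simpa using (Submodule.eq_bot_iff I).2 hI⟩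

/-- Up to left units, a quaternion `a` whose norm is exactly divisible by `p` has one right
divisor of norm `p`: the generator of the left ideal `H a + H p`. -/
theorem exists_right_divisor {p : ℕ} (hp : p.Prime) {a : hurwitz} {m : ℤ}
    (ha : norm a = p * m) (hm : ¬ (p : ℤ) ∣ m) :
    ∃ g : hurwitz, norm g = p ∧ (∃ c, a = c * g) ∧ ∃ x y : hurwitz, g = x * a + y * p := by
  obtain ⟨g, hg⟩ := exists_eq_span_singleton (Ideal.span {a, (p : hurwitz)})
  have mem (x : hurwitz) : x ∈ Ideal.span {a, (p : hurwitz)} ↔ ∃ c, c * g = x := by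
    rw [hg, Ideal.mem_span_singleton']
  obtain ⟨c, hc⟩ := (mem a).1 (Ideal.subset_span (by simp))
  obtain ⟨d, hd⟩ := (mem p).1 (Ideal.subset_span (by simp))
  obtain ⟨x, y, hxy⟩ := Submodule.mem_span_pair.1 ((mem g).2 ⟨1, one_mul g⟩)
  simp only [smul_eq_mul] at hxy
  refine ⟨g, ?_, ⟨c, hc.symm⟩, x, y, hxy.symm⟩
  have hp0 : (p : ℤ) ≠ 0 := by exact_mod_cast hp.ne_zero
  have not_dvd (z : hurwitz) : norm a ≠ norm (z * p) := by
    intro h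
    have hz : norm (z * p) = p * (p * norm z) := by
      rw [norm_mul, ← Int.cast_natCast, norm_intCast]
      ring
    rw [ha, hz] at h
    exact hm ⟨_, mul_left_cancel₀ hp0 h⟩
  have hnorm : norm d * norm g = (p : ℤ) ^ 2 := by
    rw [← norm_mul, hd, ← Int.cast_natCast, norm_intCast]
  have hgn : (norm g).natAbs ∣ p ^ 2 := by
    have := Int.natAbs_dvd_natAbs.2 (Dvd.intro_left _ hnorm)
    rwa [Int.natAbs_pow, Int.natAbs_natCast] at this
  obtain ⟨i, hi, hgi⟩ := (Nat.dvd_prime_pow hp).1 hgn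
  have hgi' : norm g = (p : ℤ) ^ i := by
    rw [← Int.natAbs_of_nonneg (norm_nonneg g), hgi, Nat.cast_pow]
  interval_cases i
  · -- If `g` is a unit then `p` divides `conj a`.
    exfalso
    have h1 : conj g * g = 1 := by simp [conj_mul_self, hgi']
    refine not_dvd (conj g * (x * m) + conj g * (y * conj a)) ?_
    rw [← norm_conj]
    congr 1
    have hcomm : (p : hurwitz) * conj a = conj a * p := (Nat.cast_commute p (conj a)).eq
    have hmp : (norm a : hurwitz) = m * p := by rw [ha, mul_comm]; push_cast; rfl
    calc conj a = conj g * (x * a + y * p) * conj a := by rw [hxy, h1, one_mul]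
      _ = conj g * x * (a * conj a) + conj g * y * (p * conj a) := by noncomm_ring
      _ = _ := by rw [mul_conj, hcomm, hmp]; noncomm_ring
  · simpa using hgi'
  · -- If `g` is associated to `p` then `p` divides `a`.
    exfalso
    have hd1 : norm d = 1 := by
      rw [hgi'] at hnorm
      exact mul_right_cancel₀ (pow_ne_zero 2 hp0) (by rw [hnorm, one_mul])
    refine not_dvd (c * conj d) ?_
    rw [← hc, ← hd, mul_assoc, ← mul_assoc (conj d), conj_mul_self, hd1]
    simp

/-- Any right divisor of `a` of norm `p` divides the generator of `H a + H p` on the right, and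
both have norm `p`. -/
theorem right_divisor_unique {p : ℕ} (hp : p.Prime) {a : hurwitz} {m : ℤ}
    (ha : norm a = p * m) (hm : ¬ (p : ℤ) ∣ m) {g h c d : hurwitz} (hg : norm g = p)
    (hh : norm h = p) (hag : a = c * g) (hah : a = d * h) : ∃ u : hurwitzˣ, h = u * g := by
  have hp0 : (p : ℤ) ≠ 0 := by exact_mod_cast hp.ne_zero
  obtain ⟨k, hk, -, x, y, hxy⟩ := exists_right_divisor hp ha hm
  have main {g c : hurwitz} (hg : norm g = p) (hag : a = c * g) : ∃ u : hurwitzˣ, k = u * g := by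
    have hpg : (p : hurwitz) = conj g * g := by rw [conj_mul_self, hg]; simp
    have hkg : k = (x * c + y * conj g) * g := by
      rw [add_mul, mul_assoc x, ← hag, mul_assoc y, ← hpg, hxy]
    have : IsUnit (x * c + y * conj g) := by
      rw [isUnit_iff_norm_eq_one]
      have := congrArg norm hkg
      rw [norm_mul, hk, hg] at this
      exact mul_right_cancel₀ hp0 (by rw [← this, one_mul])
    obtain ⟨u, hu⟩ := this
    exact ⟨u, by rw [hu, ← hkg]⟩
  obtain ⟨u, hu⟩ := main hg hag
  obtain ⟨v, hv⟩ := main hh hah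
  refine ⟨v⁻¹ * u, ?_⟩
  rw [Units.val_mul, mul_assoc, ← hu, hv, Units.inv_mul_cancel_left]


/-! ### Metacommutation as a permutation -/

/-- If `π * α = c * π'` with `N(π) = N(π') = p`, then `N(c) = N(α)`. -/
theorem norm_eq_of_mul_eq {p : ℕ} (hp : p.Prime) {π π' α c : hurwitz} (hπ : norm π = p)
    (hπ' : norm π' = p) (h : π * α = c * π') : norm c = norm α := by
  have hp0 : (p : ℤ) ≠ 0 := by exact_mod_cast hp.ne_zero
  have := congrArg norm h
  rw [norm_mul, norm_mul, hπ, hπ', mul_comm (norm c)] at this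
  exact (mul_left_cancel₀ hp0 this).symm

/-- Metacommutation by `conj α` undoes metacommutation by `α`. -/
theorem mul_conj_eq_of_mul_eq {p : ℕ} (hp : p.Prime) {π π' α c : hurwitz} (hπ : norm π = p)
    (hπ' : norm π' = p) (hα : norm α ≠ 0) (h : π * α = c * π') :
    π' * conj α = conj c * π := by
  have hn : (norm α : hurwitz) ≠ 0 := by
    rwa [ne_eq, ← norm_eq_zero, norm_intCast, sq_eq_zero_iff]
  apply mul_left_cancel₀ hn
  calc (norm α : hurwitz) * (π' * conj α) = conj c * (c * π') * conj α := by
        rw [← norm_eq_of_mul_eq hp hπ hπ' h, ← conj_mul_self]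
        noncomm_ring
    _ = conj c * π * (norm α : hurwitz) := by
        rw [← h, ← mul_conj]
        noncomm_ring
    _ = (norm α : hurwitz) * (conj c * π) := (Int.cast_commute _ _).eq.symm

/-- The relation on classes of primes above `p` induced by right multiplication by `α`:
`[π]` is related to `[π']` when `π'` is a right divisor of `π * α`. For `α` of norm prime to `p`
it is the graph of a permutation. -/
def Metacommutes {p : ℕ} (α : hurwitz) (x y : PrimeClasses p) : Prop :=
  ∃ π π' : {π : hurwitz // IsPrimeAbove π p}, primeClass π = x ∧ primeClass π' = y ∧
    ∃ c, (π : hurwitz) * α = c * (π' : hurwitz)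

theorem metacommutes_primeClass {p : ℕ} {α : hurwitz}
    {π π' : {π : hurwitz // IsPrimeAbove π p}} :
    Metacommutes α (primeClass π) (primeClass π') ↔
      ∃ c, (π : hurwitz) * α = c * (π' : hurwitz) := by
  refine ⟨?_, fun h => ⟨π, π', rfl, rfl, h⟩⟩
  rintro ⟨ρ, ρ', h, h', c, hc⟩
  obtain ⟨u, hu⟩ := Quotient.exact h
  obtain ⟨v, hv⟩ := Quotient.exact h'.symm
  exact ⟨u * c * v, by rw [hu, mul_assoc, hc, hv]; noncomm_ring⟩

theorem exists_metacommutes {p : ℕ} (hp : p.Prime) {α : hurwitz} (hα : ¬ (p : ℤ) ∣ norm α)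
    (x : PrimeClasses p) : ∃ y, Metacommutes α x y := by
  obtain ⟨π, rfl⟩ := Quotient.exists_rep x
  have hn : norm (π * α) = p * norm α := by rw [norm_mul, π.2.2]
  obtain ⟨g, hg, hc, -⟩ := exists_right_divisor hp hn hα
  exact ⟨primeClass ⟨g, (isPrimeAbove_iff hp).2 hg⟩, metacommutes_primeClass.2 hc⟩

theorem Metacommutes.unique {p : ℕ} (hp : p.Prime) {α : hurwitz} (hα : ¬ (p : ℤ) ∣ norm α)
    {x y z : PrimeClasses p} (hy : Metacommutes α x y) (hz : Metacommutes α x z) : y = z := by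
  obtain ⟨π, rfl⟩ := Quotient.exists_rep x
  obtain ⟨π₁, rfl⟩ := Quotient.exists_rep y
  obtain ⟨π₂, rfl⟩ := Quotient.exists_rep z
  obtain ⟨c, hc⟩ := metacommutes_primeClass.1 hy
  obtain ⟨d, hd⟩ := metacommutes_primeClass.1 hz
  have hn : norm (π * α) = p * norm α := by rw [norm_mul, π.2.2]
  exact Quotient.sound (right_divisor_unique hp hn hα π₁.2.2 π₂.2.2 hc hd)

theorem Metacommutes.conj {p : ℕ} (hp : p.Prime) {α : hurwitz} (hα : ¬ (p : ℤ) ∣ norm α)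
    {x y : PrimeClasses p} (h : Metacommutes α x y) : Metacommutes (conj α) y x := by
  obtain ⟨π, π', rfl, rfl, c, hc⟩ := h
  refine metacommutes_primeClass.2 ⟨_, mul_conj_eq_of_mul_eq hp π.2.2 π'.2.2 ?_ hc⟩
  rintro h
  simp [h] at hα

theorem exists_perm_metacommutes {p : ℕ} (hp : p.Prime) {α : hurwitz}
    (hα : ¬ (p : ℤ) ∣ norm α) :
    ∃ τ : Equiv.Perm (PrimeClasses p), ∀ x, Metacommutes α x (τ x) := by
  have hα' : ¬ (p : ℤ) ∣ norm (Hurwitz.conj α) := by rwa [norm_conj]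
  choose f hf using exists_metacommutes hp hα
  choose g hg using exists_metacommutes hp hα'
  refine ⟨⟨f, g, fun x => (hg (f x)).unique hp hα' ((hf x).conj hp hα), fun y => ?_⟩, hf⟩
  have := (hg y).conj hp hα'
  rw [conj_conj] at this
  exact (hf (g y)).unique hp hα this

theorem isMetacommutationMap_iff {p q : ℕ} (hp : p.Prime) (hq : q.Prime) {ξ : hurwitz}
    (hξ : norm ξ = q) (hpξ : ¬ (p : ℤ) ∣ norm ξ) {τ : PrimeClasses p → PrimeClasses p} :
    IsMetacommutationMap ξ p q τ ↔ ∀ x, Metacommutes ξ x (τ x) := by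
  have key (π π' : {π : hurwitz // IsPrimeAbove π p}) :
      (∃ ξ', IsPrimeAbove ξ' q ∧ (π : hurwitz) * ξ = ξ' * π') ↔
        Metacommutes ξ (primeClass π) (primeClass π') := by
    rw [metacommutes_primeClass]
    refine ⟨fun ⟨c, _, hc⟩ => ⟨c, hc⟩, fun ⟨c, hc⟩ => ⟨c, ?_, hc⟩⟩
    rw [isPrimeAbove_iff hq, norm_eq_of_mul_eq hp π.2.2 π'.2.2 hc, hξ]
  constructor
  · intro h x
    obtain ⟨π, rfl⟩ := Quotient.exists_rep x
    obtain ⟨π', hπ'⟩ := Quotient.exists_rep (τ (primeClass π))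
    have := (key π π').1 ((h π π').1 hπ'.symm)
    rwa [show primeClass π' = τ (primeClass π) from hπ'] at this
  · intro h π π'
    rw [key]
    refine ⟨fun h' => h' ▸ h _, fun h' => (h _).unique hp hpξ h'⟩

/-! ### Periods of moved points -/

theorem metacommutes_pow_iterate {p : ℕ} {α : hurwitz} {τ : PrimeClasses p → PrimeClasses p}
    (hτ : ∀ x, Metacommutes α x (τ x)) (k : ℕ) (x : PrimeClasses p) :
    Metacommutes (α ^ k) x (τ^[k] x) := by
  induction k with
  | zero =>
    obtain ⟨π, rfl⟩ := Quotient.exists_rep x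
    exact ⟨π, π, rfl, rfl, 1, by simp⟩
  | succ k ih =>
    rw [Function.iterate_succ_apply']
    have h := hτ (τ^[k] x)
    obtain ⟨π, π', rfl, h', c, hc⟩ := ih
    rw [← h'] at h ⊢
    obtain ⟨π'', hπ''⟩ := Quotient.exists_rep (τ (primeClass π'))
    rw [← hπ''] at h ⊢
    obtain ⟨d, hd⟩ := metacommutes_primeClass.1 h
    refine metacommutes_primeClass.2 ⟨c * d, ?_⟩
    rw [pow_succ, ← mul_assoc, hc, mul_assoc, hd, mul_assoc]

/-- If `α ^ k = A * α + B` with integers `A`, `B`, then a point moved by `α` is fixed by `α ^ k`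
exactly when `p` divides `A`, that is, when `α ^ k` is scalar modulo `p`. -/
theorem isPeriodicPt_iff {p : ℕ} (hp : p.Prime) {α : hurwitz} (hα : ¬ (p : ℤ) ∣ norm α)
    {τ : PrimeClasses p → PrimeClasses p} (hτ : ∀ x, Metacommutes α x (τ x)) {k : ℕ} {A B : ℤ}
    (hk : α ^ k = A * α + B) {x : PrimeClasses p} (hx : τ x ≠ x) :
    Function.IsPeriodicPt τ k x ↔ (p : ℤ) ∣ A := by
  have hαk : ¬ (p : ℤ) ∣ norm (α ^ k) := by
    rw [norm_pow]
    exact fun h => hα ((Nat.prime_iff_prime_int.1 hp).dvd_of_dvd_pow h)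
  have h1 : Function.IsPeriodicPt τ k x ↔ Metacommutes (α ^ k) x x := by
    have hm := metacommutes_pow_iterate hτ k x
    refine ⟨fun h => ?_, fun h => hm.unique hp hαk h⟩
    have h' : τ^[k] x = x := h
    rwa [h'] at hm
  have h2 : ¬ Metacommutes α x x := fun h => hx ((hτ x).unique hp hα h)
  rw [h1]
  obtain ⟨π, rfl⟩ := Quotient.exists_rep x
  have hpπ : (p : hurwitz) = conj π * π := by
    rw [conj_mul_self, π.2.2]
    simp
  have e1 : (π : hurwitz) * (A : hurwitz) = A * π := (Int.cast_commute A _).eq.symm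
  have e2 : (π : hurwitz) * (B : hurwitz) = B * π := (Int.cast_commute B _).eq.symm
  have expand : (π : hurwitz) * α ^ k = A * (π * α) + B * π := by
    rw [hk, mul_add, ← mul_assoc, e1, e2, mul_assoc]
  have e3 : (p : hurwitz) * (π * α) = π * α * conj π * π := by
    rw [(Nat.cast_commute p _).eq, hpπ, mul_assoc _ (conj _)]
  constructor
  · intro h
    -- If `p` does not divide `A`, then `π * α` is a combination of `p * (π * α)` and
    -- `A * (π * α)`, both of which are left multiples of `π`.
    by_contra hA
    obtain ⟨c, hc⟩ := metacommutes_primeClass.1 h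
    obtain ⟨r, s, hrs⟩ := ((Nat.prime_iff_prime_int.1 hp).coprime_iff_not_dvd.2 hA)
    apply h2
    refine metacommutes_primeClass.2 ⟨r * (π * α * conj π) + s * (c - B), ?_⟩
    have hrs' : (r : hurwitz) * p + s * A = 1 := by
      exact_mod_cast congrArg (Int.cast (R := hurwitz)) hrs
    calc (π : hurwitz) * α = (r * p + s * A) * (π * α) := by rw [hrs', one_mul]
      _ = r * (p * (π * α)) + s * (A * (π * α) + B * π - B * π) := by noncomm_ring
      _ = _ := by
        rw [e3, ← expand, hc]
        noncomm_ring
  · rintro ⟨m, rfl⟩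
    refine metacommutes_primeClass.2 ⟨m * (π * α * conj π) + B, ?_⟩
    have hm : (((p : ℤ) * m : ℤ) : hurwitz) = m * p := by
      rw [mul_comm]
      push_cast
      rfl
    rw [expand, hm, mul_assoc (m : hurwitz), e3]
    noncomm_ring

theorem pow_succ_eq {α : hurwitz} {k : ℕ} {A B : ℤ} (h : α ^ k = A * α + B) :
    α ^ (k + 1) = ((A * trace α + B : ℤ) : hurwitz) * α + ((-(A * norm α) : ℤ) : hurwitz) := by
  rw [pow_succ, h, add_mul, mul_assoc, ← pow_two, sq_eq]
  push_cast
  noncomm_ring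

/-! ### Existence of moved points -/

/-- Suppose that `ξ` fixes every class of primes above `p`, and let `α = 1 + u` with
`u = x i + y j + z k` have norm divisible by `p` exactly once. Then `p` divides `α * ξ * conj α`.
Modulo `p`, where `|u| ^ 2 = -1`, the imaginary part of twice this product is
`2 (v + (u ⬝ v) u + u × v)`, where `v = (B, C, D)` is the imaginary part of `2 ξ`. -/
theorem dvd_of_forall_fixed {p : ℕ} (hp : p.Prime) {ξ : hurwitz}
    (h : ∀ π : hurwitz, norm π = p → ∃ d, π * ξ = d * π) {x y z k : ℤ} (hk0 : 0 < k)
    (hkp : k < p) (hk : x ^ 2 + y ^ 2 + z ^ 2 + 1 = k * p) {B C D : ℤ}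
    (hB : (ξ : ℍ[ℝ]).imI = B / 2) (hC : (ξ : ℍ[ℝ]).imJ = C / 2) (hD : (ξ : ℍ[ℝ]).imK = D / 2) :
    (p : ℤ) ∣ 2 * (B + (x * B + y * C + z * D) * x + (y * D - z * C)) ∧
    (p : ℤ) ∣ 2 * (C + (x * B + y * C + z * D) * y + (z * B - x * D)) ∧
    (p : ℤ) ∣ 2 * (D + (x * B + y * C + z * D) * z + (x * C - y * B)) := by
  obtain ⟨α, hα₀, hα₁, hα₂, hα₃⟩ : ∃ α : hurwitz, (α : ℍ[ℝ]).re = 1 ∧ (α : ℍ[ℝ]).imI = x ∧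
      (α : ℍ[ℝ]).imJ = y ∧ (α : ℍ[ℝ]).imK = z :=
    ⟨⟨⟨1, x, y, z⟩, 2, 2 * x, 2 * y, 2 * z, by simp [Int.ModEq], by simp⟩, rfl, rfl, rfl, rfl⟩
  have hn : norm α = p * k := by
    have : (norm α : ℝ) = ((p * k : ℤ) : ℝ) := by
      rw [cast_norm, Quaternion.normSq_def', mul_comm, ← hk, hα₀, hα₁, hα₂, hα₃]
      push_cast
      ring
    exact_mod_cast this
  obtain ⟨π, hπ, ⟨c, hc⟩, -⟩ := exists_right_divisor hp hn
    (fun h => absurd (Int.le_of_dvd hk0 h) (by omega))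
  obtain ⟨d, hd⟩ := h π hπ
  have hprod : α * ξ * conj α = (p : ℤ) * (c * d * conj c) := by
    calc α * ξ * conj α = c * (π * ξ) * (conj π * conj c) := by rw [hc, conj_mul]; noncomm_ring
      _ = c * d * (π * conj π) * conj c := by rw [hd]; noncomm_ring
      _ = ((p : ℤ) : hurwitz) * (c * d * conj c) := by
        rw [mul_conj, hπ, mul_assoc (c * d), (Int.cast_commute _ (conj c)).eq, ← mul_assoc,
          (Int.cast_commute _ _).eq]
  obtain ⟨w, hw⟩ : ∃ w, w = c * d * conj c := ⟨_, rfl⟩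
  rw [← hw] at hprod
  obtain ⟨-, W₁, W₂, W₃, -, -, h₁, h₂, h₃⟩ := w.2
  have hprod' := congrArg (fun z : hurwitz => (z : ℍ[ℝ])) hprod
  simp only [Subring.coe_mul, coe_conj, coe_intCast] at hprod'
  have hk' : (x : ℝ) ^ 2 + y ^ 2 + z ^ 2 + 1 = k * p := by exact_mod_cast hk
  have hI := congrArg (fun z : ℍ[ℝ] => z.imI) hprod'
  have hJ := congrArg (fun z : ℍ[ℝ] => z.imJ) hprod'
  have hK := congrArg (fun z : ℍ[ℝ] => z.imK) hprod'
  simp only [Quaternion.re_mul, Quaternion.imI_mul, Quaternion.imJ_mul, Quaternion.imK_mul,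
    Quaternion.re_star, Quaternion.imI_star, Quaternion.imJ_star, Quaternion.imK_star,
    Quaternion.re_coe, Quaternion.imI_coe, Quaternion.imJ_coe, Quaternion.imK_coe,
    hα₀, hα₁, hα₂, hα₃, hB, hC, hD, h₁, h₂, h₃] at hI hJ hK
  refine ⟨⟨W₁ + k * B, ?_⟩, ⟨W₂ + k * C, ?_⟩, ⟨W₃ + k * D, ?_⟩⟩
  · have : (2 * (B + (x * B + y * C + z * D) * x + (y * D - z * C)) : ℝ) = p * (W₁ + k * B) := by
      linear_combination 2 * hI + B * hk'
    exact_mod_cast this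
  · have : (2 * (C + (x * B + y * C + z * D) * y + (z * B - x * D)) : ℝ) = p * (W₂ + k * C) := by
      linear_combination 2 * hJ + C * hk'
    exact_mod_cast this
  · have : (2 * (D + (x * B + y * C + z * D) * z + (x * C - y * B)) : ℝ) = p * (W₃ + k * D) := by
      linear_combination 2 * hK + D * hk'
    exact_mod_cast this

/-- A quaternion fixing every class of primes above `p` is scalar modulo `p`, so that its
discriminant `Tr(ξ) ^ 2 - 4 N(ξ)` vanishes modulo `p`. -/
theorem dvd_discrim_of_forall_fixed {p : ℕ} (hp : p.Prime) (hp2 : p ≠ 2) {ξ : hurwitz}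
    (h : ∀ π : hurwitz, norm π = p → ∃ d, π * ξ = d * π) :
    (p : ℤ) ∣ trace ξ ^ 2 - 4 * norm ξ := by
  have := Fact.mk hp
  obtain ⟨a, b, k, hk0, hkp, hk⟩ := Int.exists_sq_add_sq_add_one_eq_mul p
  have hk' : (a : ℤ) ^ 2 + b ^ 2 + 1 = k * p := by exact_mod_cast hk
  have hk0' : (0 : ℤ) < k := by exact_mod_cast hk0
  have hkp' : (k : ℤ) < p := by exact_mod_cast hkp
  obtain ⟨A, B, C, D, -, hA, hB, hC, hD⟩ := ξ.2
  have four (m : ℤ) (hm : (p : ℤ) ∣ 4 * m) : (p : ℤ) ∣ m := by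
    have hpi := Nat.prime_iff_prime_int.1 hp
    refine (hpi.dvd_or_dvd hm).resolve_left fun h4 => hp2 ?_
    have : p ∣ 2 ^ 2 := by exact_mod_cast h4
    exact (Nat.prime_dvd_prime_iff_eq hp Nat.prime_two).1 (hp.dvd_of_dvd_pow this)
  -- Averaging over `1 + u` and `1 - u` isolates the coordinate in which `u` vanishes.
  have dB : (p : ℤ) ∣ B := by
    obtain ⟨r, hr⟩ := (dvd_of_forall_fixed hp h (x := 0) (y := a) (z := b) hk0' hkp'
      (by linarith) hB hC hD).1
    obtain ⟨s, hs⟩ := (dvd_of_forall_fixed hp h (x := 0) (y := -a) (z := -b) hk0' hkp'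
      (by linarith) hB hC hD).1
    exact four _ ⟨r + s, by linear_combination hr + hs⟩
  have dC : (p : ℤ) ∣ C := by
    obtain ⟨r, hr⟩ := (dvd_of_forall_fixed hp h (x := a) (y := 0) (z := b) hk0' hkp'
      (by linarith) hB hC hD).2.1
    obtain ⟨s, hs⟩ := (dvd_of_forall_fixed hp h (x := -a) (y := 0) (z := -b) hk0' hkp'
      (by linarith) hB hC hD).2.1
    exact four _ ⟨r + s, by linear_combination hr + hs⟩
  have dD : (p : ℤ) ∣ D := by
    obtain ⟨r, hr⟩ := (dvd_of_forall_fixed hp h (x := a) (y := b) (z := 0) hk0' hkp'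
      (by linarith) hB hC hD).2.2
    obtain ⟨s, hs⟩ := (dvd_of_forall_fixed hp h (x := -a) (y := -b) (z := 0) hk0' hkp'
      (by linarith) hB hC hD).2.2
    exact four _ ⟨r + s, by linear_combination hr + hs⟩
  have : trace ξ ^ 2 - 4 * norm ξ = -(B * B + C * C + D * D) := by
    have : (trace ξ ^ 2 - 4 * norm ξ : ℝ) = -(B * B + C * C + D * D) := by
      rw [cast_trace, cast_norm, Quaternion.normSq_def', hA, hB, hC, hD]
      ring
    exact_mod_cast this
  rw [this]
  exact (((dB.mul_right B).add (dC.mul_right C)).add (dD.mul_right D)).neg_right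

theorem exists_apply_ne {p : ℕ} (hp : p.Prime) (hp2 : p ≠ 2) {α : hurwitz}
    (hdisc : ¬ (p : ℤ) ∣ trace α ^ 2 - 4 * norm α) {τ : PrimeClasses p → PrimeClasses p}
    (hτ : ∀ x, Metacommutes α x (τ x)) : ∃ x, τ x ≠ x := by
  by_contra! hfix
  refine hdisc (dvd_discrim_of_forall_fixed hp hp2 fun π hπ => ?_)
  have := hτ (primeClass ⟨π, (isPrimeAbove_iff hp).2 hπ⟩)
  rw [hfix] at this
  exact metacommutes_primeClass.1 this

/-! ### Cycle lengths four and six -/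

theorem minimalPeriod_eq_four_iff {X : Type*} {f : X → X} {x : X} :
    Function.minimalPeriod f x = 4 ↔
      Function.IsPeriodicPt f 4 x ∧ ¬ Function.IsPeriodicPt f 2 x := by
  simp only [Function.isPeriodicPt_iff_minimalPeriod_dvd]
  refine ⟨fun h => by simp [h], fun ⟨h4, h2⟩ => ?_⟩
  have := Nat.le_of_dvd (by norm_num) h4
  interval_cases Function.minimalPeriod f x <;> omega

theorem minimalPeriod_eq_six_iff {X : Type*} {f : X → X} {x : X} :
    Function.minimalPeriod f x = 6 ↔ Function.IsPeriodicPt f 6 x ∧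
      ¬ Function.IsPeriodicPt f 2 x ∧ ¬ Function.IsPeriodicPt f 3 x := by
  simp only [Function.isPeriodicPt_iff_minimalPeriod_dvd]
  refine ⟨fun h => by simp [h], fun ⟨h6, h2, h3⟩ => ?_⟩
  have := Nat.le_of_dvd (by norm_num) h6
  interval_cases Function.minimalPeriod f x <;> omega

end Hurwitz

open Hurwitz in
theorem mainTheorem7 (p q : ℕ) (hp : p.Prime) (hq : q.Prime) (hp2 : p ≠ 2) (hpq : p ≠ q)
    (ξ : Hurwitz.hurwitz) (hξ : Hurwitz.IsPrimeAbove ξ q) :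
    (∃! τ : Equiv.Perm (Hurwitz.PrimeClasses p), Hurwitz.IsMetacommutationMap ξ p q τ) ∧
    ∀ τ : Equiv.Perm (Hurwitz.PrimeClasses p), Hurwitz.IsMetacommutationMap ξ p q τ →
      (Hurwitz.NontrivialCyclesHaveLength τ 4 ↔
        2 * Hurwitz.norm ξ ≡ Hurwitz.trace ξ ^ 2 [ZMOD p]) ∧
      (Hurwitz.NontrivialCyclesHaveLength τ 6 ↔
        p ≠ 3 ∧ 3 * Hurwitz.norm ξ ≡ Hurwitz.trace ξ ^ 2 [ZMOD p]) := by
  have hpi := Nat.prime_iff_prime_int.1 hp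
  have hn : ¬ (p : ℤ) ∣ Hurwitz.norm ξ := by
    rw [hξ.2]
    exact_mod_cast fun h => hpq ((Nat.prime_dvd_prime_iff_eq hp hq).1 h)
  have hiff {τ : PrimeClasses p → PrimeClasses p} :
      IsMetacommutationMap ξ p q τ ↔ ∀ x, Metacommutes ξ x (τ x) :=
    isMetacommutationMap_iff hp hq hξ.2 hn
  refine ⟨?_, fun τ hτ => ?_⟩
  · obtain ⟨τ, hτ⟩ := exists_perm_metacommutes hp hn
    refine ⟨τ, hiff.2 hτ, fun σ hσ => Equiv.ext fun x => ?_⟩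
    exact (hiff.1 hσ x).unique hp hn (hτ x)
  rw [hiff] at hτ
  have hmoved (h : ¬ (p : ℤ) ∣ Hurwitz.trace ξ ^ 2 - 4 * Hurwitz.norm ξ) : ∃ x, τ x ≠ x :=
    exists_apply_ne hp hp2 h hτ
  -- The coefficients of `ξ` in its powers, as polynomials in the trace and the norm.
  have h1 : ξ ^ 1 = ((1 : ℤ) : hurwitz) * ξ + ((0 : ℤ) : hurwitz) := by simp
  have h2 := pow_succ_eq h1
  have h3 := pow_succ_eq h2
  have h4 := pow_succ_eq h3
  have h6 := pow_succ_eq (pow_succ_eq h4)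
  have p2 {x} (hx : τ x ≠ x) : Function.IsPeriodicPt τ 2 x ↔ (p : ℤ) ∣ trace ξ := by
    rw [isPeriodicPt_iff hp hn hτ h2 hx]
    ring_nf
  have p3 {x} (hx : τ x ≠ x) : Function.IsPeriodicPt τ 3 x ↔
      (p : ℤ) ∣ trace ξ ^ 2 - Hurwitz.norm ξ := by
    rw [isPeriodicPt_iff hp hn hτ h3 hx]
    ring_nf
  have p4 {x} (hx : τ x ≠ x) :
      Function.IsPeriodicPt τ 4 x ↔
      (p : ℤ) ∣ trace ξ ∨ (p : ℤ) ∣ trace ξ ^ 2 - 2 * Hurwitz.norm ξ := by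
    rw [isPeriodicPt_iff hp hn hτ h4 hx, ← hpi.dvd_mul]
    ring_nf
  have p6 {x} (hx : τ x ≠ x) : Function.IsPeriodicPt τ 6 x ↔
      (p : ℤ) ∣ trace ξ ∨ (p : ℤ) ∣ trace ξ ^ 2 - Hurwitz.norm ξ ∨
        (p : ℤ) ∣ trace ξ ^ 2 - 3 * Hurwitz.norm ξ := by
    rw [isPeriodicPt_iff hp hn hτ h6 hx, ← hpi.dvd_mul, ← hpi.dvd_mul]
    ring_nf
  generalize Hurwitz.trace ξ = t at *
  generalize Hurwitz.norm ξ = n at *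
  have h2n : ¬ (p : ℤ) ∣ 2 * n := fun h => (hpi.dvd_or_dvd h).elim
    (fun h => hp2 ((Nat.prime_dvd_prime_iff_eq hp Nat.prime_two).1 (by exact_mod_cast h))) hn
  rw [Int.modEq_iff_dvd, Int.modEq_iff_dvd]
  constructor
  · constructor
    · rintro ⟨⟨x, hx⟩, hall⟩
      obtain ⟨h4', h2'⟩ := minimalPeriod_eq_four_iff.1 (hall x hx)
      exact ((p4 hx).1 h4').resolve_left fun h => h2' ((p2 hx).2 h)
    · intro h
      refine ⟨hmoved fun h' => h2n ?_, fun x hx => ?_⟩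
      · obtain ⟨a, ha⟩ := h
        obtain ⟨b, hb⟩ := h'
        exact ⟨a - b, by linear_combination ha - hb⟩
      · rw [minimalPeriod_eq_four_iff, p4 hx, p2 hx]
        refine ⟨.inr h, fun h' => h2n ?_⟩
        obtain ⟨a, ha⟩ := h
        obtain ⟨b, hb⟩ := h'
        exact ⟨b * t - a, by linear_combination t * hb - ha⟩
  · constructor
    · rintro ⟨⟨x, hx⟩, hall⟩
      obtain ⟨h6', h2', h3'⟩ := minimalPeriod_eq_six_iff.1 (hall x hx)
      rw [p2 hx] at h2'
      rw [p3 hx] at h3'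
      have h := (((p6 hx).1 h6').resolve_left h2').resolve_left h3'
      refine ⟨?_, h⟩
      rintro rfl
      refine h2' (hpi.dvd_of_dvd_pow (n := 2) ?_)
      obtain ⟨a, ha⟩ := h
      exact ⟨a + n, by push_cast at ha ⊢; linear_combination ha⟩
    · rintro ⟨hp3, h⟩
      have h3n : ¬ (p : ℤ) ∣ 3 * n := fun h => (hpi.dvd_or_dvd h).elim
        (fun h => hp3 ((Nat.prime_dvd_prime_iff_eq hp Nat.prime_three).1 (by exact_mod_cast h))) hn
      refine ⟨hmoved fun h' => hn ?_, fun x hx => ?_⟩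
      · obtain ⟨a, ha⟩ := h
        obtain ⟨b, hb⟩ := h'
        exact ⟨a - b, by linear_combination ha - hb⟩
      · rw [minimalPeriod_eq_six_iff, p6 hx, p2 hx, p3 hx]
        refine ⟨.inr (.inr h), fun h' => h3n ?_, fun h' => h2n ?_⟩
        · obtain ⟨a, ha⟩ := h
          obtain ⟨b, hb⟩ := h'
          exact ⟨b * t - a, by linear_combination t * hb - ha⟩
        · obtain ⟨a, ha⟩ := h
          obtain ⟨b, hb⟩ := h'
          exact ⟨b - a, by linear_combination hb - ha⟩
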